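/- **Proposition (UBC for the rational $\ell^1$-norm).** Let $M$ be an aspherical topological space, i.e., $M$ is path-connected, locally path-connected and admits a contractible universal covering. Suppose that the fundamental group $\Gamma=\pi_1(M)$ is amenable, i.e., there is an $\mathbb{R}$-linear functional $m\colon \ell^\infty(\Gamma,\mathbb{R})\to\mathbb{R}$ with $m(1)=1$, with $m(f)\ge 0$ for all $f\ge 0$, and with $m(f(\,\cdot\,\gamma))=m(f)$ for all $\gamma\in\Gamma$ and all $f$. Let $n\in\mathbb{N}=\{0,1,2,\dots\}$, let $C_*(M;\mathbb{Q})$ be the singular chain complex of $M$ with rational coefficients, and let $\bigl|\sum_j a_j\sigma_j\bigr|_1=\sum_j|a_j|$ (for pairwise distinct singular simplices $\sigma_j$) be the $\ell^1$-norm on it. Then $C_*(M;\mathbb{Q})$ satisfies the uniform boundary condition in degree $n$: there is a constant $K\in\mathbb{R}_{>0}$ such that for every null-homologous cycle $c\in C_n(M;\mathbb{Q})$ there exists a chain $b\in C_{n+1}(M;\mathbb{Q})$ with $$\partial b=c\qquad\text{and}\qquad |b|_1\le K\cdot|c|_1 .$$ More precisely, for every $\varepsilon\in\mathbb{R}_{>0}$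 the constant $K=1+\varepsilon$ has this property: for every null-homologous cycle $c\in C_n(M;\mathbb{Q})$ there exists $b\in C_{n+1}(M;\mathbb{Q})$ with $\partial b=c$ and $|b|_1\le(1+\varepsilon)\cdot|c|_1$. -/

import Mathlib

open scoped ENNReal

universe u

noncomputable section

/-! ### Amenable groups -/

/-- For a group `Γ`, an element `γ : Γ` and a bounded function `f : Γ → ℝ`, the bounded function
`x ↦ f (x * γ)`. This is the left action of `Γ` on `ℓ^∞(Γ, ℝ)` induced by right translation of
`Γ` on itself. -/
def rightTranslate {Γ : Type u} [Group Γ] (γ : Γ) (f : lp (fun _ : Γ => ℝ) ∞) :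
    lp (fun _ : Γ => ℝ) ∞ :=
  ⟨fun x => f (x * γ), by
    apply memℓp_infty
    obtain ⟨C, hC⟩ := memℓp_infty_iff.mp (lp.memℓp f)
    exact ⟨C, by rintro _ ⟨x, rfl⟩; exact hC ⟨x * γ, rfl⟩⟩⟩

/-- An invariant mean on a group `Γ`: an `ℝ`-linear functional on `ℓ^∞(Γ, ℝ)` that is normalised,
positive and invariant under the translation action of `Γ`. -/
structure IsInvariantMean {Γ : Type u} [Group Γ] (m : lp (fun _ : Γ => ℝ) ∞ →ₗ[ℝ] ℝ) : Prop where
  map_one : m 1 = 1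
  nonneg : ∀ f : lp (fun _ : Γ => ℝ) ∞, (∀ x, 0 ≤ f x) → 0 ≤ m f
  map_rightTranslate : ∀ (γ : Γ) (f : lp (fun _ : Γ => ℝ) ∞), m (rightTranslate γ f) = m f

/-- A (discrete) group is amenable if it admits an invariant mean. -/
def IsAmenable (Γ : Type u) [Group Γ] : Prop :=
  ∃ m : lp (fun _ : Γ => ℝ) ∞ →ₗ[ℝ] ℝ, IsInvariantMean m

/-! ### Aspherical spaces -/

/-- A continuous map `p : E → M` is a universal covering if it is a surjective covering map with
simply connected total space. -/
structure IsUniversalCovering {E M : Type u} [TopologicalSpace E] [TopologicalSpace M]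
    (p : E → M) : Prop where
  isCoveringMap : IsCoveringMap p
  surjective : Function.Surjective p
  simplyConnected : SimplyConnectedSpace E

/-- A space is aspherical if it is path-connected, locally path-connected and admits a
contractible universal covering. (The total space of a universal covering of `M` has as many
points as `M × π₁(M)`, so that it may be taken in the universe of `M`.) -/
structure IsAspherical (M : Type u) [TopologicalSpace M] : Prop where
  pathConnected : PathConnectedSpace M
  locPathConnected : LocallyPathConnectedSpace M
  exists_contractible_universalCovering :
    ∃ (E : Type u) (_ : TopologicalSpace E) (p : E → M),
      IsUniversalCovering p ∧ ContractibleSpace E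

/-! ### The singular chain complex with the `ℓ¹`-norm -/

/-- Singular `n`-simplices of `M`: continuous maps from the standard `n`-simplex to `M`. -/
abbrev SingularSimplex (M : Type u) [TopologicalSpace M] (n : ℕ) : Type u :=
  C(stdSimplex ℝ (Fin (n + 1)), M)

/-- The inclusion of the standard `n`-simplex as the face of the standard `(n+1)`-simplex
opposite to the `i`-th vertex. -/
def faceInclusion (n : ℕ) (i : Fin (n + 2)) :
    C(stdSimplex ℝ (Fin (n + 1)), stdSimplex ℝ (Fin (n + 2))) :=
  ⟨stdSimplex.map i.succAbove, stdSimplex.continuous_map _⟩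

/-- The `i`-th face of a singular `(n+1)`-simplex. -/
def SingularSimplex.face {M : Type u} [TopologicalSpace M] {n : ℕ} (σ : SingularSimplex M (n + 1))
    (i : Fin (n + 2)) : SingularSimplex M n :=
  σ.comp (faceInclusion n i)

/-- Singular `n`-chains of `M` with rational coefficients: the `ℚ`-vector space with basis the
singular `n`-simplices of `M`. -/
abbrev SingularChain (M : Type u) [TopologicalSpace M] (n : ℕ) : Type u :=
  SingularSimplex M n →₀ ℚ

/-- The `ℓ¹`-norm `|∑ⱼ aⱼ σⱼ|₁ = ∑ⱼ |aⱼ|` (for pairwise distinct `σⱼ`) on singular chains. -/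
def l1Norm {M : Type u} [TopologicalSpace M] {n : ℕ} (c : SingularChain M n) : ℝ :=
  c.sum fun _ a => |(a : ℝ)|

section Norm

variable {M : Type u} [TopologicalSpace M] {n : ℕ}

theorem l1Norm_add_le (c c' : SingularChain M n) : l1Norm (c + c') ≤ l1Norm c + l1Norm c' := by
  classical
  have h : ∀ d : SingularChain M n, d.support ⊆ c.support ∪ c'.support →
      l1Norm d = ∑ σ ∈ c.support ∪ c'.support, |(d σ : ℝ)| := fun d hd =>
    Finsupp.sum_of_support_subset _ hd _ (by simp)
  rw [h _ Finsupp.support_add, h c Finset.subset_union_left, h c' Finset.subset_union_right,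
    ← Finset.sum_add_distrib]
  refine Finset.sum_le_sum fun σ _ => ?_
  rw [Finsupp.add_apply, Rat.cast_add]
  exact abs_add_le _ _

/-- The `ℓ¹`-norm makes the singular chains a normed abelian group. -/
instance SingularChain.instNormedAddCommGroup : NormedAddCommGroup (SingularChain M n) :=
  AddGroupNorm.toNormedAddCommGroup
    { toFun := l1Norm
      map_zero' := by simp [l1Norm]
      add_le' := l1Norm_add_le
      neg' := fun c => by simp [l1Norm, Finsupp.sum_neg_index]
      eq_zero_of_map_eq_zero' := fun c hc => by
        ext σ
        by_contra hσ
        have h := (Finset.sum_eq_zero_iff_of_nonneg (fun _ _ => abs_nonneg _)).mp hc σ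
          (Finsupp.mem_support_iff.mpr hσ)
        exact hσ (by simpa using h) }

theorem SingularChain.norm_def (c : SingularChain M n) : ‖c‖ = l1Norm c := rfl

theorem SingularChain.norm_single (σ : SingularSimplex M n) (a : ℚ) :
    ‖(Finsupp.single σ a : SingularChain M n)‖ = |(a : ℝ)| := by
  simp [SingularChain.norm_def, l1Norm]

end Norm

section Boundary

variable (M : Type u) [TopologicalSpace M] (n : ℕ)

/-- The singular boundary operator, `∂σ = ∑ᵢ (-1)ⁱ • (i-th face of σ)`. -/
def singularBoundary : SingularChain M (n + 1) →ₗ[ℚ] SingularChain M n :=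
  Finsupp.linearCombination ℚ fun σ : SingularSimplex M (n + 1) =>
    ∑ i : Fin (n + 2), (-1 : ℚ) ^ (i : ℕ) • (Finsupp.single (σ.face i) 1 : SingularChain M n)

theorem singularBoundary_single (σ : SingularSimplex M (n + 1)) (a : ℚ) :
    singularBoundary M n (Finsupp.single σ a) =
      ∑ i : Fin (n + 2), Finsupp.single (σ.face i) ((-1 : ℚ) ^ (i : ℕ) * a) := by
  simp [singularBoundary, Finsupp.linearCombination_single, Finset.smul_sum, mul_comm]

theorem norm_singularBoundary_le (c : SingularChain M (n + 1)) :
    ‖singularBoundary M n c‖ ≤ (n + 2 : ℝ) * ‖c‖ := by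
  have h : singularBoundary M n c =
      ∑ σ ∈ c.support, singularBoundary M n (Finsupp.single σ (c σ)) := by
    conv_lhs => rw [← Finsupp.sum_single c, Finsupp.sum, map_sum]
  rw [h, SingularChain.norm_def c, l1Norm, Finsupp.sum, Finset.mul_sum]
  refine (norm_sum_le _ _).trans (Finset.sum_le_sum fun σ _ => ?_)
  rw [singularBoundary_single]
  refine (norm_sum_le _ _).trans (le_of_eq ?_)
  simp only [SingularChain.norm_single, Rat.cast_mul, Rat.cast_pow, Rat.cast_neg, Rat.cast_one,
    abs_mul, abs_pow, abs_neg, abs_one, one_pow, one_mul, Finset.sum_const, Finset.card_univ,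
    Fintype.card_fin, nsmul_eq_mul, Nat.cast_add, Nat.cast_ofNat]

/-- The simplicial identity for iterated faces. -/
theorem SingularSimplex.face_face {M : Type u} [TopologicalSpace M] {n : ℕ}
    (σ : SingularSimplex M (n + 2)) {i j : Fin (n + 2)} (h : i ≤ j) :
    (σ.face i.castSucc).face j = (σ.face j.succ).face i := by
  have hc : i.castSucc.succAbove ∘ j.succAbove = j.succ.succAbove ∘ i.succAbove := by
    funext k
    have h' : (i : ℕ) ≤ j := h
    simp only [Function.comp_apply, Fin.succAbove, Fin.ext_iff, Fin.lt_def]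
    split_ifs <;> simp_all <;> omega
  ext x
  simp only [SingularSimplex.face, faceInclusion, ContinuousMap.comp_apply, ContinuousMap.coe_mk,
    stdSimplex.map_comp_apply, hc]

theorem singularBoundary_singularBoundary (c : SingularChain M (n + 2)) :
    singularBoundary M n (singularBoundary M (n + 1) c) = 0 := by
  induction c using Finsupp.induction_linear with
  | zero => simp only [map_zero]
  | add c c' hc hc' => rw [map_add, map_add, hc, hc', add_zero]
  | single σ a =>
    rw [singularBoundary_single, map_sum]
    simp_rw [singularBoundary_single]
    rw [← Finset.sum_product']
    refine Finset.sum_involution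
      (fun p _ => if h : (p.1 : ℕ) ≤ p.2 then (p.2.succ, ⟨p.1, by omega⟩)
        else (p.2.castSucc, ⟨(p.1 : ℕ) - 1, by omega⟩)) ?_ ?_ ?_ ?_
    · rintro ⟨i, j⟩ -
      by_cases h : (i : ℕ) ≤ j
      · have hf := σ.face_face (i := ⟨i, by omega⟩) (j := j) h
        have hi : (⟨i, by omega⟩ : Fin (n + 2)).castSucc = i := rfl
        rw [hi] at hf
        rw [dif_pos h]
        dsimp only
        rw [hf, ← Finsupp.single_add]
        refine (congrArg _ ?_).trans (Finsupp.single_zero _)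
        rw [Fin.val_succ]
        ring
      · have hf := σ.face_face (i := j) (j := ⟨(i : ℕ) - 1, by omega⟩)
          (by rw [Fin.le_def]; simp only; omega)
        have hi : (⟨(i : ℕ) - 1, by omega⟩ : Fin (n + 2)).succ = i := by
          ext; simp only [Fin.val_succ]; omega
        rw [hi] at hf
        obtain ⟨k, hk⟩ : ∃ k, (i : ℕ) = k + 1 := ⟨(i : ℕ) - 1, by omega⟩
        rw [dif_neg h]
        dsimp only
        rw [hf, ← Finsupp.single_add]
        refine (congrArg _ ?_).trans (Finsupp.single_zero _)
        rw [Fin.val_castSucc, hk, Nat.add_sub_cancel]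
        ring
    · rintro ⟨i, j⟩ - - hij
      by_cases h : (i : ℕ) ≤ j
      · simp only [h, dite_true, Prod.mk.injEq, Fin.ext_iff, Fin.val_succ] at hij
        omega
      · simp only [h, dite_false, Prod.mk.injEq, Fin.ext_iff, Fin.val_castSucc] at hij
        omega
    · intro p _
      exact Finset.mem_product.mpr ⟨Finset.mem_univ _, Finset.mem_univ _⟩
    · rintro ⟨i, j⟩ -
      by_cases h : (i : ℕ) ≤ j
      · have h' : ¬ ((j : ℕ) + 1 ≤ i) := by omega
        simp [h, h']
      · have h' : (j : ℕ) ≤ (i : ℕ) - 1 := by omega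
        simp [h, h', Fin.ext_iff]
        omega

end Boundary

/-- The singular chain complex `C_*(M;ℚ)` with the `ℓ¹`-norm, as a chain complex of (semi-)normed
abelian groups and bounded homomorphisms. -/
def singularChainComplex (M : Type u) [TopologicalSpace M] : ChainComplex SemiNormedGrp.{u} ℕ :=
  ChainComplex.of (fun n => SemiNormedGrp.of (SingularChain M n))
    (fun n => SemiNormedGrp.ofHom
      ((singularBoundary M n).toAddMonoidHom.mkNormedAddGroupHom (n + 2)
        (norm_singularBoundary_le M n)))
    (fun n => SemiNormedGrp.ext fun c => singularBoundary_singularBoundary M n c)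

theorem singularChainComplex_d_apply (M : Type u) [TopologicalSpace M] (n : ℕ)
    (b : SingularChain M (n + 1)) :
    (singularChainComplex M).d (n + 1) n b = singularBoundary M n b := by
  have h : (singularChainComplex M).d (n + 1) n = SemiNormedGrp.ofHom
      ((singularBoundary M n).toAddMonoidHom.mkNormedAddGroupHom (n + 2)
        (norm_singularBoundary_le M n)) := by
    dsimp only [singularChainComplex, ChainComplex.of]
    exact ChainComplex.of_d (fun n => SemiNormedGrp.of (SingularChain M n)) _ n
  rw [h]
  rfl

/-! ### The uniform boundary condition -/

/-- A chain `c` of degree `n` is a null-homologous cycle if it is the boundary of some chain of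
degree `n + 1` (boundaries are automatically cycles). -/
def IsNullHomologous (C : ChainComplex SemiNormedGrp.{u} ℕ) (n : ℕ) (c : C.X n) : Prop :=
  ∃ b : C.X (n + 1), C.d (n + 1) n b = c

/-- Every null-homologous cycle `c` of degree `n` has a filling `b` with `|b| ≤ K * |c|`. -/
def UBCWithConstant (C : ChainComplex SemiNormedGrp.{u} ℕ) (n : ℕ) (K : ℝ) : Prop :=
  ∀ c : C.X n, IsNullHomologous C n c →
    ∃ b : C.X (n + 1), C.d (n + 1) n b = c ∧ ‖b‖ ≤ K * ‖c‖

/-- The uniform boundary condition in degree `n`. -/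
def SatisfiesUBC (C : ChainComplex SemiNormedGrp.{u} ℕ) (n : ℕ) : Prop :=
  ∃ K : ℝ, 0 < K ∧ UBCWithConstant C n K

end

/-!
Fix a contraction `H` of the universal covering `E` to a point. The proof combines three facts.

* *Duality* (`exists_bounded_annihilator`). Suppose that every rational filling of `∂ b₀` has norm
  at least `r`, that is, that `b₀` has distance at least `r` from the rational `(n+1)`-cycles.
  Rational combinations of rational cycles are dense in the real span of the rational cycles inside
  `ℓ¹`, so `b₀` has distance at least `r` from this span, too, and Hahn–Banach provides a real
  cochain `f` of sup-norm at most `1` that vanishes on all rational cycles and satisfies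
  `r ≤ f b₀`.
* *Coning* (`IsCoveringMap.apply_eq_sum_projCone`). If a singular simplex `τ` of `M` is lifted to
  `E`, then the contraction `H` yields a cone over the lift. Its projection to `M` has `τ` as face
  opposite to the apex, and its other faces are the projected cones over the induced lifts of the
  faces of `τ`. Evaluating `f` on the boundary of this cone expresses `f τ` as the alternating sum
  of the values of `f` on the cones over the faces of `τ`, for every choice of the lift of `τ`.
* *Averaging* (`IsCoveringMap.exists_bounded_primitive`). The fundamental group acts simply
  transitively on the lifts of a simplex, so an invariant mean averages the values of `f` over the
  cones over all lifts. The average `φ σ` does not depend on the way in which the lifts of `σ` are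
  enumerated, whence `f = φ ∘ ∂`, and `φ` has sup-norm at most `1` because means do not increase
  the norm.

Therefore `r ≤ f b₀ = φ (∂ b₀) ≤ |∂ b₀|₁`. So for every `r > |∂ b₀|₁` there is a rational filling of
`∂ b₀` of norm at most `r` (`IsAspherical.exists_filling`). The factor `1 + ε` makes the inequality
strict for nonzero `∂ b₀`, and `0` is a filling of the zero chain.
-/

/-! ### Simplices as cones over their faces -/

theorem stdSimplex.map_apply_of_injective {X Y : Type*} [Fintype X] [Fintype Y] {f : X → Y}
    (hf : Function.Injective f) (s : stdSimplex ℝ X) (x : X) :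
    stdSimplex.map f s (f x) = s x := by
  classical
  rw [stdSimplex.map_coe, FunOnFinite.linearMap_apply_apply]
  rw [Finset.sum_eq_single x] <;> simp +contextual [hf.eq_iff]

theorem stdSimplex.map_apply_of_notMem_range {X Y : Type*} [Fintype X] [Fintype Y] {f : X → Y}
    (s : stdSimplex ℝ X) {y : Y} (hy : ∀ x, f x ≠ y) :
    stdSimplex.map f s y = 0 := by
  classical
  rw [stdSimplex.map_coe, FunOnFinite.linearMap_apply_apply]
  exact Finset.sum_eq_zero fun x hx => absurd (by simpa using hx) (hy x)

theorem faceInclusion_apply_succAbove (n : ℕ) (i : Fin (n + 2))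
    (s : stdSimplex ℝ (Fin (n + 1))) (j : Fin (n + 1)) :
    faceInclusion n i s (i.succAbove j) = s j :=
  stdSimplex.map_apply_of_injective Fin.succAbove_right_injective s j

theorem faceInclusion_apply_self (n : ℕ) (i : Fin (n + 2))
    (s : stdSimplex ℝ (Fin (n + 1))) :
    faceInclusion n i s i = 0 :=
  stdSimplex.map_apply_of_notMem_range s fun j => Fin.succAbove_ne i j

/-- The parametrisation `(s, u) ↦ (s, (1 - s) u)` of the standard `(n+1)`-simplex as the cone,
with apex the vertex `0`, over its face opposite to the vertex `0`. -/
def conePoint (n : ℕ) :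
    C(unitInterval × stdSimplex ℝ (Fin (n + 1)), stdSimplex ℝ (Fin (n + 2))) where
  toFun q := ⟨Fin.cons (q.1 : ℝ) fun j => (1 - (q.1 : ℝ)) * q.2 j, by
    refine ⟨fun j => ?_, ?_⟩
    · refine Fin.cases ?_ (fun j => ?_) j
      · exact q.1.2.1
      · exact mul_nonneg (sub_nonneg.mpr q.1.2.2) (q.2.2.1 j)
    · rw [Fin.sum_univ_succ]
      simp only [Fin.cons_zero, Fin.cons_succ, ← Finset.mul_sum, stdSimplex.sum_eq_one]
      ring⟩
  continuous_toFun := by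
    refine Continuous.subtype_mk (continuous_pi fun j => ?_) _
    refine Fin.cases ?_ (fun j => ?_) j
    · exact continuous_subtype_val.comp continuous_fst
    · exact (continuous_const.sub (continuous_subtype_val.comp continuous_fst)).mul
        ((continuous_apply j).comp (continuous_subtype_val.comp continuous_snd))

@[simp]
theorem conePoint_apply_zero {n : ℕ} (s : unitInterval) (u : stdSimplex ℝ (Fin (n + 1))) :
    conePoint n (s, u) 0 = (s : ℝ) := rfl

@[simp]
theorem conePoint_apply_succ {n : ℕ} (s : unitInterval) (u : stdSimplex ℝ (Fin (n + 1)))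
    (j : Fin (n + 1)) : conePoint n (s, u) j.succ = (1 - (s : ℝ)) * u j := rfl

theorem conePoint_surjective (n : ℕ) : Function.Surjective (conePoint n) := by
  intro t
  have hsum : t 0 + ∑ j : Fin (n + 1), t j.succ = 1 := by
    rw [← Fin.sum_univ_succ]; exact stdSimplex.sum_eq_one t
  rcases eq_or_ne (t 0) 1 with h | h
  · refine ⟨(1, stdSimplex.vertex 0), stdSimplex.ext (funext fun j => ?_)⟩
    refine Fin.cases ?_ (fun j => ?_) j
    · exact h.symm
    · have h0 : ∑ j : Fin (n + 1), t j.succ = 0 := by linarith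
      have := (Finset.sum_eq_zero_iff_of_nonneg fun j _ => t.2.1 (Fin.succ j)).mp h0 j
        (Finset.mem_univ _)
      refine Eq.trans ?_ this.symm
      refine (conePoint_apply_succ _ _ _).trans ?_
      simp
  · have h1 : 0 < 1 - t 0 := sub_pos.mpr (lt_of_le_of_ne (stdSimplex.le_one t 0) h)
    refine ⟨(⟨t 0, t.2.1 0, stdSimplex.le_one t 0⟩,
      ⟨fun j => t j.succ / (1 - t 0), fun j => div_nonneg (t.2.1 _) h1.le, ?_⟩),
      stdSimplex.ext (funext fun j => ?_)⟩
    · rw [← Finset.sum_div, div_eq_one_iff_eq h1.ne']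
      linarith
    · refine Fin.cases ?_ (fun j => ?_) j
      · rfl
      · exact mul_div_cancel₀ _ h1.ne'

/-- A continuous surjection from a compact space onto a Hausdorff space is a quotient map. -/
theorem isQuotientMap_conePoint (n : ℕ) : Topology.IsQuotientMap (conePoint n) :=
  (conePoint n).continuous.isClosedMap.isQuotientMap (conePoint n).continuous
    (conePoint_surjective n)

theorem eq_of_conePoint_eq {n : ℕ} {s s' : unitInterval} {u u' : stdSimplex ℝ (Fin (n + 1))}
    (h : conePoint n (s, u) = conePoint n (s', u')) : s = s' ∧ (s = 1 ∨ u = u') := by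
  have hs : s = s' := Subtype.ext (congrArg (fun t => t 0) h)
  subst hs
  refine ⟨rfl, or_iff_not_imp_left.mpr fun h1 => stdSimplex.ext (funext fun j => ?_)⟩
  have hj : (1 - (s : ℝ)) * u j = (1 - (s : ℝ)) * u' j := congrArg (fun t => t j.succ) h
  refine mul_left_cancel₀ (sub_ne_zero.mpr fun h2 => h1 (Subtype.ext h2.symm)) hj

theorem conePoint_zero {n : ℕ} (u : stdSimplex ℝ (Fin (n + 1))) :
    conePoint n (0, u) = faceInclusion n 0 u := by
  refine stdSimplex.ext (funext fun j => ?_)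
  refine Fin.cases ?_ (fun j => ?_) j
  · exact (faceInclusion_apply_self n 0 u).symm
  · refine Eq.trans ?_ (faceInclusion_apply_succAbove n 0 u j).symm
    refine (conePoint_apply_succ _ _ _).trans ?_
    simp

/-- The inclusion of a face that contains the apex is the cone over a face inclusion. -/
theorem faceInclusion_succ_conePoint {n : ℕ} (i : Fin (n + 2)) (s : unitInterval)
    (u : stdSimplex ℝ (Fin (n + 1))) :
    faceInclusion (n + 1) i.succ (conePoint n (s, u)) =
      conePoint (n + 1) (s, faceInclusion n i u) := by
  refine stdSimplex.ext (funext fun j => ?_)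
  rcases Fin.eq_self_or_eq_succAbove i.succ j with rfl | ⟨k, rfl⟩
  · refine (faceInclusion_apply_self _ _ _).trans ?_
    refine Eq.trans ?_ (conePoint_apply_succ _ _ _).symm
    rw [faceInclusion_apply_self, mul_zero]
  · refine (faceInclusion_apply_succAbove _ _ _ _).trans ?_
    refine Fin.cases ?_ (fun k => ?_) k
    · rw [Fin.succ_succAbove_zero]; rfl
    · rw [Fin.succ_succAbove_succ]
      refine (conePoint_apply_succ _ _ _).trans ?_
      refine Eq.trans ?_ (conePoint_apply_succ _ _ _).symm
      rw [faceInclusion_apply_succAbove]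

/-! ### Cones of singular simplices in a contractible space -/

section Cone

variable {E : Type u} [TopologicalSpace E] {e : E}
  (H : (ContinuousMap.id E).Homotopy (ContinuousMap.const E e))

theorem SingularSimplex.factorsThrough_conePoint {n : ℕ} (σ : SingularSimplex E n) :
    Function.FactorsThrough
      (H.toContinuousMap.comp ((ContinuousMap.id unitInterval).prodMap σ)) (conePoint n) := by
  rintro ⟨s, u⟩ ⟨s', u'⟩ h
  obtain ⟨rfl, rfl | rfl⟩ := eq_of_conePoint_eq h
  · exact (H.apply_one (σ u)).trans (H.apply_one (σ u')).symm
  · rfl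

/-- The cone over a singular simplex `σ` of a space `E` with respect to a contraction `H` of `E`
to a point `e`. It sends the vertex `0` to `e` and the point `(s, (1 - s) u)` to `H (s, σ u)`. -/
noncomputable def SingularSimplex.cone {n : ℕ} (σ : SingularSimplex E n) :
    SingularSimplex E (n + 1) :=
  (isQuotientMap_conePoint n).lift
    (H.toContinuousMap.comp ((ContinuousMap.id unitInterval).prodMap σ))
    (σ.factorsThrough_conePoint H)

theorem SingularSimplex.cone_conePoint {n : ℕ} (σ : SingularSimplex E n) (s : unitInterval)
    (u : stdSimplex ℝ (Fin (n + 1))) : σ.cone H (conePoint n (s, u)) = H (s, σ u) :=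
  DFunLike.congr_fun ((isQuotientMap_conePoint n).lift_comp
    (H.toContinuousMap.comp ((ContinuousMap.id unitInterval).prodMap σ))
    (σ.factorsThrough_conePoint H)) (s, u)

theorem SingularSimplex.face_zero_cone {n : ℕ} (σ : SingularSimplex E n) :
    (σ.cone H).face 0 = σ := by
  refine ContinuousMap.ext fun u => ?_
  refine (congrArg (σ.cone H) (conePoint_zero u).symm).trans ?_
  rw [cone_conePoint]
  exact H.apply_zero _

theorem SingularSimplex.face_succ_cone {n : ℕ} (σ : SingularSimplex E (n + 1)) (i : Fin (n + 2)) :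
    (σ.cone H).face i.succ = (σ.face i).cone H := by
  refine ContinuousMap.ext fun t => ?_
  obtain ⟨⟨s, u⟩, rfl⟩ := conePoint_surjective n t
  refine (congrArg (σ.cone H) (faceInclusion_succ_conePoint i s u)).trans ?_
  rw [cone_conePoint, cone_conePoint]
  rfl

end Cone

/-! ### Duality for the rational `ℓ¹`-norm -/

section Duality

variable {X : Type*}

/-- The inclusion of the finitely supported rational functions on `X` into `ℓ¹(X, ℝ)`. -/
noncomputable def Finsupp.ratToL1 (X : Type*) :
    (X →₀ ℚ) →ₗ[ℚ] lp (fun _ : X => ℝ) 1 := by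
  classical
  exact Finsupp.linearCombination ℚ fun x : X => lp.single (E := fun _ : X => ℝ) 1 x (1 : ℝ)

theorem Finsupp.norm_ratToL1 (c : X →₀ ℚ) :
    ‖Finsupp.ratToL1 X c‖ = c.sum fun _ a => |(a : ℝ)| := by
  classical
  have h : Finsupp.ratToL1 X c =
      ∑ x ∈ c.support, lp.single (E := fun _ : X => ℝ) 1 x ((c x : ℝ)) := by
    rw [Finsupp.ratToL1, Finsupp.linearCombination_apply, Finsupp.sum]
    refine Finset.sum_congr rfl fun x _ => ?_
    ext y
    by_cases hy : y = x
    · subst hy; simp [Rat.smul_def]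
    · simp [hy]
  have h1 := lp.norm_sum_single (p := 1) (E := fun _ : X => ℝ) (by simp)
    (fun x => (c x : ℝ)) c.support
  rw [← h] at h1
  simpa only [ENNReal.toReal_one, Real.rpow_one, Real.norm_eq_abs, Finsupp.sum] using h1

/-- Rational combinations of elements of a rational subspace approximate its real span. -/
theorem exists_norm_sub_lt_of_mem_span_image {V F : Type*} [AddCommGroup V] [Module ℚ V]
    [SeminormedAddCommGroup F] [NormedSpace ℝ F] [Module ℚ F] (J : V →ₗ[ℚ] F) (Z : Submodule ℚ V)
    {w : F} (hw : w ∈ Submodule.span ℝ (J '' Z)) {δ : ℝ} (hδ : 0 < δ) :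
    ∃ z ∈ Z, ‖w - J z‖ < δ := by
  induction hw using Submodule.span_induction generalizing δ with
  | mem w hw =>
    obtain ⟨z, hz, rfl⟩ := hw
    exact ⟨z, hz, by simpa using hδ⟩
  | zero => exact ⟨0, Z.zero_mem, by simpa using hδ⟩
  | add w w' _ _ hw hw' =>
    obtain ⟨z, hz, h⟩ := hw (half_pos hδ)
    obtain ⟨z', hz', h'⟩ := hw' (half_pos hδ)
    refine ⟨z + z', Z.add_mem hz hz', ?_⟩
    rw [map_add, add_sub_add_comm]
    linarith [norm_add_le (w - J z) (w' - J z')]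
  | smul r w _ hw =>
    obtain ⟨z, hz, h⟩ := hw (δ := δ / (2 * (|r| + 1))) (by positivity)
    -- `w` is approximated by `J z`, and then the real factor `r` by a rational `q`
    obtain ⟨q, hq, hq'⟩ := exists_rat_btwn
      (lt_add_of_pos_right r (show 0 < δ / (2 * (‖J z‖ + 1)) by positivity))
    refine ⟨q • z, Z.smul_mem q hz, ?_⟩
    have hJ : J (q • z) = (q : ℝ) • J z := by
      rw [map_smul, Rat.cast_smul_eq_qsmul]
    have h1 : ‖r • w - r • J z‖ < δ / 2 := by
      rw [← smul_sub, norm_smul, Real.norm_eq_abs]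
      calc |r| * ‖w - J z‖ ≤ |r| * (δ / (2 * (|r| + 1))) := by gcongr
        _ < (|r| + 1) * (δ / (2 * (|r| + 1))) := by
          have : 0 < δ / (2 * (|r| + 1)) := by positivity
          nlinarith
        _ = δ / 2 := by field_simp
    have h2 : ‖r • J z - (q : ℝ) • J z‖ ≤ δ / 2 := by
      rw [← sub_smul, norm_smul, Real.norm_eq_abs]
      have h3 : |r - q| ≤ δ / (2 * (‖J z‖ + 1)) := by rw [abs_le]; constructor <;> linarith
      calc |r - q| * ‖J z‖ ≤ δ / (2 * (‖J z‖ + 1)) * (‖J z‖ + 1) := by gcongr; linarith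
        _ = δ / 2 := by field_simp
    rw [hJ]
    linarith [norm_sub_le_norm_sub_add_norm_sub (r • w) (r • J z) ((q : ℝ) • J z)]

/-- Hahn–Banach for the rational `ℓ¹`-norm: if `b` has distance at least `r` from a rational
subspace `Z`, then this is witnessed by a function on `X` with values in `[-1, 1]` whose linear
extension vanishes on `Z`. -/
theorem exists_bounded_annihilator (Z : Submodule ℚ (X →₀ ℚ)) (b : X →₀ ℚ) {r : ℝ}
    (hr : ∀ z ∈ Z, r ≤ (b - z).sum fun _ a => |(a : ℝ)|) :
    ∃ f : X → ℝ, (∀ x, |f x| ≤ 1) ∧ (∀ z ∈ Z, Finsupp.linearCombination ℚ f z = 0) ∧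
      r ≤ Finsupp.linearCombination ℚ f b := by
  classical
  set J := Finsupp.ratToL1 X with hJ
  set W := Submodule.span ℝ (J '' Z)
  obtain ⟨g, hg, hgb⟩ := exists_dual_vector'' ℝ (Submodule.Quotient.mk (J b) : _ ⧸ W)
  have hf (c : X →₀ ℚ) : Finsupp.linearCombination ℚ
      (fun x => g (Submodule.Quotient.mk (J (Finsupp.single x 1)) : _ ⧸ W)) c =
        g (Submodule.Quotient.mk (J c) : _ ⧸ W) := by
    have : Finsupp.linearCombination ℚ
      (fun x => g (Submodule.Quotient.mk (J (Finsupp.single x 1)) : _ ⧸ W)) =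
        ((g.toLinearMap ∘ₗ W.mkQ).toAddMonoidHom.toRatLinearMap) ∘ₗ J := by
      ext x
      simp
    exact DFunLike.congr_fun this c
  refine ⟨fun x => g (Submodule.Quotient.mk (J (Finsupp.single x 1)) : _ ⧸ W), fun x => ?_,
    fun z hz => ?_, ?_⟩
  · calc _ ≤ ‖g‖ * ‖(Submodule.Quotient.mk (J (Finsupp.single x 1)) : _ ⧸ W)‖ := g.le_opNorm _
      _ ≤ 1 * ‖J (Finsupp.single x 1)‖ := by
        gcongr
        exact Submodule.Quotient.norm_mk_le _ _
      _ = 1 := by rw [hJ, Finsupp.norm_ratToL1]; simp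
  · rw [hf, (Submodule.Quotient.mk_eq_zero W).mpr (Submodule.subset_span ⟨z, hz, rfl⟩), map_zero]
  · rw [hf, hgb]
    refine le_of_forall_pos_lt_add fun δ hδ => ?_
    obtain ⟨v, hv, hvn⟩ := Submodule.Quotient.norm_mk_lt
      (Submodule.Quotient.mk (J b) : _ ⧸ W) (half_pos hδ)
    obtain ⟨z, hz, hzn⟩ := exists_norm_sub_lt_of_mem_span_image J Z
      ((Submodule.Quotient.eq W).mp hv.symm) (half_pos hδ)
    have h1 := hr z hz
    rw [← Finsupp.norm_ratToL1, map_sub] at h1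
    have h2 : J b - J z = v + (J b - v - J z) := by abel
    have h3 : r ≤ ‖v‖ + ‖J b - v - J z‖ := h1.trans (h2 ▸ norm_add_le _ _)
    simp only [RCLike.ofReal_real_eq_id, id_eq] at *
    linarith

end Duality

/-! ### Invariant means -/

theorem IsInvariantMean.abs_le {Γ : Type u} [Group Γ] {m : lp (fun _ : Γ => ℝ) ∞ →ₗ[ℝ] ℝ}
    (hm : IsInvariantMean m) {g : lp (fun _ : Γ => ℝ) ∞} {C : ℝ} (hg : ∀ γ, |g γ| ≤ C) :
    |m g| ≤ C := by
  have h1 : m (C • 1) = C := by rw [map_smul, hm.map_one, smul_eq_mul, mul_one]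
  rw [_root_.abs_le]
  constructor
  · have := hm.nonneg (C • 1 + g) fun γ => by
      have := (_root_.abs_le.mp (hg γ)).1
      simp only [lp.coeFn_add, lp.coeFn_smul, Pi.add_apply, Pi.smul_apply, lp.infty_coeFn_one,
        Pi.one_apply, smul_eq_mul]
      linarith
    rw [map_add, h1] at this
    linarith
  · have := hm.nonneg (C • 1 - g) fun γ => by
      have := (_root_.abs_le.mp (hg γ)).2
      simp only [lp.coeFn_sub, lp.coeFn_smul, Pi.sub_apply, Pi.smul_apply, lp.infty_coeFn_one,
        Pi.one_apply, smul_eq_mul]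
      linarith
    rw [map_sub, h1] at this
    linarith

/-! ### Lifts of singular simplices -/

section Lift

instance (k : ℕ) : LocallyPathConnectedSpace (stdSimplex ℝ (Fin (k + 1))) :=
  (convex_stdSimplex ℝ (Fin (k + 1))).locallyPathConnectedSpace

instance (k : ℕ) : ContractibleSpace (stdSimplex ℝ (Fin (k + 1))) :=
  (convex_stdSimplex ℝ (Fin (k + 1))).contractibleSpace
    ⟨_, (stdSimplex.vertex (S := ℝ) (0 : Fin (k + 1))).2⟩

variable {E M : Type u} [TopologicalSpace E] [TopologicalSpace M] {p : E → M}
  (cov : IsCoveringMap p) {n : ℕ}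

/-- The lift of a singular simplex to a covering space, with prescribed value at the vertex `0`. -/
noncomputable def IsCoveringMap.liftSimplex (σ : SingularSimplex M n)
    (e : p ⁻¹' {σ (stdSimplex.vertex 0)}) : SingularSimplex E n :=
  (cov.existsUnique_continuousMap_lifts σ (stdSimplex.vertex 0) e.1 e.2).choose

theorem IsCoveringMap.liftSimplex_vertex (σ : SingularSimplex M n)
    (e : p ⁻¹' {σ (stdSimplex.vertex 0)}) :
    cov.liftSimplex σ e (stdSimplex.vertex 0) = e :=
  (cov.existsUnique_continuousMap_lifts σ (stdSimplex.vertex 0) e.1 e.2).choose_spec.1.1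

theorem IsCoveringMap.comp_liftSimplex (σ : SingularSimplex M n)
    (e : p ⁻¹' {σ (stdSimplex.vertex 0)}) : p ∘ cov.liftSimplex σ e = σ :=
  (cov.existsUnique_continuousMap_lifts σ (stdSimplex.vertex 0) e.1 e.2).choose_spec.1.2

theorem IsCoveringMap.eq_liftSimplex {σ : SingularSimplex M n}
    {e : p ⁻¹' {σ (stdSimplex.vertex 0)}} {s : SingularSimplex E n}
    (h0 : s (stdSimplex.vertex 0) = e) (hs : p ∘ s = σ) : s = cov.liftSimplex σ e :=
  (cov.existsUnique_continuousMap_lifts σ (stdSimplex.vertex 0) e.1 e.2).choose_spec.2 s ⟨h0, hs⟩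

/-- The homotopy class of the path in a singular simplex from its vertex `0` to the vertex `0` of
its `i`-th face. -/
noncomputable def SingularSimplex.facePath (τ : SingularSimplex M (n + 1)) (i : Fin (n + 2)) :
    Path.Homotopic.Quotient (τ (stdSimplex.vertex 0)) (τ.face i (stdSimplex.vertex 0)) :=
  .mk ((PathConnectedSpace.somePath (stdSimplex.vertex 0)
    (faceInclusion n i (stdSimplex.vertex 0))).map τ.continuous)

/-- The faces of a lift are lifts of the faces. For the face opposite to the vertex `0` the base
vertex changes, so the prescribed value is transported by monodromy. -/
theorem IsCoveringMap.face_liftSimplex (τ : SingularSimplex M (n + 1)) (i : Fin (n + 2))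
    (e : p ⁻¹' {τ (stdSimplex.vertex 0)}) :
    (cov.liftSimplex τ e).face i =
      cov.liftSimplex (τ.face i) (cov.monodromy (τ.facePath i) e) := by
  have hface : ∀ t, p ((cov.liftSimplex τ e).face i t) = τ.face i t := fun t =>
    congrFun (cov.comp_liftSimplex τ e) _
  refine cov.eq_liftSimplex ?_ (funext hface)
  refine (congrArg Subtype.val (cov.monodromy_eq_of_map_eq
    (ey := ⟨(cov.liftSimplex τ e).face i (stdSimplex.vertex 0), hface _⟩)
    ((Path.Homotopic.Quotient.mk ((PathConnectedSpace.somePath (stdSimplex.vertex 0)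
      (faceInclusion n i (stdSimplex.vertex 0))).map (cov.liftSimplex τ e).continuous)).cast
      (cov.liftSimplex_vertex τ e).symm rfl) ?_)).symm
  refine congrArg Path.Homotopic.Quotient.mk (Path.ext (funext fun t => ?_))
  exact congrFun (cov.comp_liftSimplex τ e) _

variable {e : E} (H : (ContinuousMap.id E).Homotopy (ContinuousMap.const E e))

/-- The projection to `M` of the cone over the lift of a singular simplex of `M` that takes the
value `a` at the vertex `0`. -/
noncomputable def IsCoveringMap.projCone (σ : SingularSimplex M n)
    (a : p ⁻¹' {σ (stdSimplex.vertex 0)}) : SingularSimplex M (n + 1) :=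
  (ContinuousMap.mk p cov.continuous).comp ((cov.liftSimplex σ a).cone H)

theorem IsCoveringMap.face_zero_projCone (σ : SingularSimplex M n)
    (a : p ⁻¹' {σ (stdSimplex.vertex 0)}) : (cov.projCone H σ a).face 0 = σ := by
  change (ContinuousMap.mk p cov.continuous).comp (((cov.liftSimplex σ a).cone H).face 0) = σ
  rw [SingularSimplex.face_zero_cone]
  exact ContinuousMap.ext fun t => congrFun (cov.comp_liftSimplex σ a) t

theorem IsCoveringMap.face_succ_projCone (τ : SingularSimplex M (n + 1))
    (a : p ⁻¹' {τ (stdSimplex.vertex 0)}) (i : Fin (n + 2)) :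
    (cov.projCone H τ a).face i.succ =
      cov.projCone H (τ.face i) (cov.monodromy (τ.facePath i) a) := by
  change (ContinuousMap.mk p cov.continuous).comp (((cov.liftSimplex τ a).cone H).face i.succ) = _
  rw [SingularSimplex.face_succ_cone, face_liftSimplex]
  rfl

/-- The value on `τ` of a cochain vanishing on boundaries, in terms of the cones over the faces
of `τ`: the cochain is evaluated on the boundary of the cone over the lift of `τ` at `a`. -/
theorem IsCoveringMap.apply_eq_sum_projCone {f : SingularSimplex M (n + 1) → ℝ}
    (hf : ∀ b, Finsupp.linearCombination ℚ f (singularBoundary M (n + 1) b) = 0)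
    (τ : SingularSimplex M (n + 1)) (a : p ⁻¹' {τ (stdSimplex.vertex 0)}) :
    f τ = ∑ i : Fin (n + 2), (-1 : ℝ) ^ (i : ℕ) *
      f (cov.projCone H (τ.face i) (cov.monodromy (τ.facePath i) a)) := by
  have h := hf (Finsupp.single (cov.projCone H τ a) 1)
  rw [singularBoundary_single, Fin.sum_univ_succ, face_zero_projCone] at h
  simp only [face_succ_projCone, map_add, map_sum, Finsupp.linearCombination_single, Rat.smul_def,
    Fin.val_zero, Fin.val_succ, pow_zero, mul_one, Rat.cast_one, one_mul, pow_succ, mul_neg,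
    Rat.cast_neg, Rat.cast_pow, neg_mul, Finset.sum_neg_distrib] at h
  linarith

end Lift

/-! ### Averaging over the fundamental group -/

section Averaging

variable {E M : Type u} [TopologicalSpace E] [TopologicalSpace M] {p : E → M}
  (cov : IsCoveringMap p) {e : E} (H : (ContinuousMap.id E).Homotopy (ContinuousMap.const E e))
  {x : M} (e₀ : p ⁻¹' {x}) {n : ℕ} {f : SingularSimplex M (n + 1) → ℝ} (hf : ∀ σ, |f σ| ≤ 1)

/-- The values of a bounded cochain on the cones over the lifts of a singular simplex, as a
bounded function on the fundamental group. The class `β` of paths to the vertex `0` of the simplex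
serves to enumerate the lifts by the fundamental group. As the product `γ * δ` in
`FundamentalGroup M x` traverses `δ` before `γ`, the inverse of `γ` is used, so that a change of
`β` amounts to a translation from the right. -/
noncomputable def IsCoveringMap.coneValues (σ : SingularSimplex M n)
    (β : Path.Homotopic.Quotient x (σ (stdSimplex.vertex 0))) :
    lp (fun _ : FundamentalGroup M x => ℝ) ∞ :=
  ⟨fun γ => f (cov.projCone H σ
      (cov.monodromy (Path.Homotopic.Quotient.trans (γ⁻¹ : FundamentalGroup M x) β) e₀)),
    memℓp_infty ⟨1, by rintro _ ⟨γ, rfl⟩; exact hf _⟩⟩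

/-- The mean does not depend on the enumeration of the lifts: replacing `β'` by `β = α β'`, for a
loop `α`, translates the function of values from the right by `α⁻¹`. -/
theorem IsCoveringMap.mean_coneValues_eq {m : lp (fun _ : FundamentalGroup M x => ℝ) ∞ →ₗ[ℝ] ℝ}
    (hm : IsInvariantMean m) (σ : SingularSimplex M n)
    (β β' : Path.Homotopic.Quotient x (σ (stdSimplex.vertex 0))) :
    m (cov.coneValues H e₀ hf σ β) = m (cov.coneValues H e₀ hf σ β') := by
  let α : FundamentalGroup M x := β.trans β'.symm
  have hα : Path.Homotopic.Quotient.trans α β' = β := by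
    rw [Path.Homotopic.Quotient.trans_assoc, Path.Homotopic.Quotient.symm_trans,
      Path.Homotopic.Quotient.trans_refl]
  rw [← hm.map_rightTranslate α⁻¹ (cov.coneValues H e₀ hf σ β')]
  congr 1
  refine Subtype.ext (funext fun γ => ?_)
  have h : Path.Homotopic.Quotient.trans ((γ * α⁻¹)⁻¹ : FundamentalGroup M x) β' =
      Path.Homotopic.Quotient.trans (γ⁻¹ : FundamentalGroup M x) β := by
    rw [mul_inv_rev, inv_inv, FundamentalGroup.mul_def, Path.Homotopic.Quotient.trans_assoc, hα]
  exact congrArg (fun ω => f (cov.projCone H σ (cov.monodromy ω e₀))) h.symm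

/-- Averaging over the cones yields a primitive of norm at most `1` of a cocycle of norm at most
`1`. -/
theorem IsCoveringMap.exists_bounded_primitive [PathConnectedSpace M] (cov : IsCoveringMap p)
    (H : (ContinuousMap.id E).Homotopy (ContinuousMap.const E e)) (e₀ : p ⁻¹' {x})
    (hf : ∀ σ, |f σ| ≤ 1)
    (hx : IsAmenable (FundamentalGroup M x))
    (hf0 : ∀ b, Finsupp.linearCombination ℚ f (singularBoundary M (n + 1) b) = 0) :
    ∃ φ : SingularSimplex M n → ℝ, (∀ σ, |φ σ| ≤ 1) ∧
      ∀ b, Finsupp.linearCombination ℚ φ (singularBoundary M n b) =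
        Finsupp.linearCombination ℚ f b := by
  obtain ⟨m, hm⟩ := hx
  refine ⟨fun σ => m (cov.coneValues H e₀ hf σ (.mk (PathConnectedSpace.somePath _ _))),
    fun σ => hm.abs_le fun γ => hf _, fun b => ?_⟩
  induction b using Finsupp.induction_linear with
  | zero => simp only [map_zero]
  | add b b' hb hb' => rw [map_add, map_add, map_add, hb, hb']
  | single τ a =>
    let β : Path.Homotopic.Quotient x (τ (stdSimplex.vertex 0)) :=
      .mk (PathConnectedSpace.somePath _ _)
    have h : f τ = ∑ i : Fin (n + 2), (-1 : ℝ) ^ (i : ℕ) *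
        m (cov.coneValues H e₀ hf (τ.face i) (β.trans (τ.facePath i))) := by
      have h1 : f τ • (1 : lp (fun _ : FundamentalGroup M x => ℝ) ∞) =
          ∑ i : Fin (n + 2), (-1 : ℝ) ^ (i : ℕ) •
            cov.coneValues H e₀ hf (τ.face i) (β.trans (τ.facePath i)) := by
        refine Subtype.ext (funext fun γ => ?_)
        have h2 := cov.apply_eq_sum_projCone H hf0 τ (cov.monodromy
          (Path.Homotopic.Quotient.trans (γ⁻¹ : FundamentalGroup M x) β) e₀)
        simp only [← cov.monodromy_trans_apply, Path.Homotopic.Quotient.trans_assoc] at h2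
        simp only [lp.coeFn_sum, lp.coeFn_smul, Finset.sum_apply, Pi.smul_apply,
          lp.infty_coeFn_one, Pi.one_apply, smul_eq_mul, mul_one]
        exact h2
      have h3 := congrArg m h1
      simpa only [map_smul, map_sum, hm.map_one, smul_eq_mul, mul_one] using h3
    rw [singularBoundary_single, map_sum, Finsupp.linearCombination_single, h, Finset.smul_sum]
    refine Finset.sum_congr rfl fun i _ => ?_
    rw [Finsupp.linearCombination_single, cov.mean_coneValues_eq H e₀ hf hm (τ.face i) _
      (β.trans (τ.facePath i)), Rat.smul_def, Rat.smul_def]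
    push_cast
    ring

end Averaging

/-! ### The uniform boundary condition -/

theorem SingularChain.abs_linearCombination_le {M : Type u} [TopologicalSpace M] {n : ℕ}
    {φ : SingularSimplex M n → ℝ} (hφ : ∀ σ, |φ σ| ≤ 1) (c : SingularChain M n) :
    |Finsupp.linearCombination ℚ φ c| ≤ ‖c‖ := by
  rw [Finsupp.linearCombination_apply, SingularChain.norm_def, l1Norm, Finsupp.sum, Finsupp.sum]
  refine (Finset.abs_sum_le_sum_abs _ _).trans (Finset.sum_le_sum fun σ _ => ?_)
  rw [Rat.smul_def, abs_mul]
  exact mul_le_of_le_one_right (abs_nonneg _) (hφ σ)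

/-- A boundary of norm less than `r` has a filling of norm at most `r`: otherwise a cochain as in
`exists_bounded_annihilator` would exist, and its bounded primitive would bound it by the norm of
the boundary. -/
theorem IsAspherical.exists_filling {M : Type u} [TopologicalSpace M] (hM : IsAspherical M)
    {x : M} (hx : IsAmenable (FundamentalGroup M x)) {n : ℕ} (b₀ : SingularChain M (n + 1))
    {r : ℝ} (hr : ‖singularBoundary M n b₀‖ < r) :
    ∃ b, singularBoundary M n b = singularBoundary M n b₀ ∧ ‖b‖ ≤ r := by
  have := hM.pathConnected
  obtain ⟨E, _, p, hp, hE⟩ := hM.exists_contractible_universalCovering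
  obtain ⟨e, ⟨H⟩⟩ := id_nullhomotopic E
  obtain ⟨a, ha⟩ := hp.surjective x
  by_contra! hb
  obtain ⟨f, hf, hf0, hfb⟩ := exists_bounded_annihilator (LinearMap.ker (singularBoundary M n)) b₀
    (r := r) fun z hz => (hb (b₀ - z) (by rw [map_sub, LinearMap.mem_ker.mp hz, sub_zero])).le
  obtain ⟨φ, hφ, hφb⟩ := hp.isCoveringMap.exists_bounded_primitive H ⟨a, ha⟩ hf hx
    fun b => hf0 _ (LinearMap.mem_ker.mpr (singularBoundary_singularBoundary M n b))
  have h1 := (le_abs_self _).trans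
    (SingularChain.abs_linearCombination_le hφ (singularBoundary M n b₀))
  rw [hφb] at h1
  linarith

theorem proposition1p1 {M : Type u} [TopologicalSpace M] (hM : IsAspherical M) (x : M)
    (hamen : IsAmenable (FundamentalGroup M x)) (n : ℕ) :
    SatisfiesUBC (singularChainComplex M) n ∧
      ∀ ε : ℝ, 0 < ε → UBCWithConstant (singularChainComplex M) n (1 + ε) := by
  have key : ∀ ε : ℝ, 0 < ε → UBCWithConstant (singularChainComplex M) n (1 + ε) := by
    rintro ε hε _ ⟨b₀, rfl⟩
    change SingularChain M (n + 1) at b₀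
    rcases eq_or_ne (singularBoundary M n b₀) 0 with h0 | h0
    · refine ⟨0, ?_, ?_⟩
      · rw [map_zero, singularChainComplex_d_apply, h0]
        rfl
      · rw [norm_zero]
        exact mul_nonneg (by linarith) (norm_nonneg _)
    · have hpos : 0 < ‖singularBoundary M n b₀‖ := norm_pos_iff.mpr h0
      obtain ⟨b, hb, hbn⟩ := hM.exists_filling hamen b₀
        (r := (1 + ε) * ‖singularBoundary M n b₀‖) (by nlinarith)
      refine ⟨b, ?_, ?_⟩
      · rw [singularChainComplex_d_apply, singularChainComplex_d_apply, hb]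
      · rw [singularChainComplex_d_apply]
        exact hbn
  exact ⟨⟨1 + 1, by norm_num, key 1 one_pos⟩, key⟩
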